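/- Let $\Bbbk$ be a field, let $n\ge 3$, and let $w=(n-1)(n-2)\cdots 2\,1\,(n+1)\,n\in S_{n+1}$ in one-line notation. Let $I_w\subseteq R=\Bbbk[x_{ij}]_{1\le i,j\le n+1}$ be the Schubert determinantal ideal of $w$, i.e. the ideal of polynomials in $R$ vanishing on the matrix Schubert variety $X_w$, the Zariski closure of $B_-M_wB_+$ in the space of $(n+1)\times(n+1)$ matrices, where $M_w$ has ones in the positions $(i,w(i))$ and $B_-,B_+$ are the groups of invertible lower and upper triangular matrices (points are taken in $\Bbbk$ if $\Bbbk$ is infinite and, in general, in any infinite extension field of $\Bbbk$). Let $M^{[a,b]}$ be the northwest $a\times b$ submatrix of the generic matrix $[x_{ij}]$, and call a term order antidiagonal if the lead term of every minor of $[x_{ij}]$ is its antidiagonal term. Let $r(i,j)=\#\{a\le i: w(a)\le j\}$, let $D(w)=\{(i,j): j<w(i),\ i<w^{-1}(j)\}$, and let $E(w)$ be the set of $(i,j)\in D(w)$ with $(i+1,j),(i,j+1)\notin D(w)$. A minor with row set $I$ and column set $J$ belongs to $(i,j)\in E(w)$ if $I\subseteq[i]$, $J\subseteq[j]$ and $|I|=|J|=r(i,j)+1$.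 It is elusive if for no $(i',j')\in E(w)$ with $r(i',j')<r(i,j)$ one has ($|I\cap[i']|>r(i',j')$ and $|J\cap[j']|=r(i,j)+1$) or ($|I\cap[i']|=r(i,j)+1$ and $|J\cap[j']|>r(i',j')$). The Gao--Yong Gröbner basis $\mathcal G_w$ is the set of all elusive minors. Then $$\mathcal G_w=\{x_{ij}: i+j\le n-1\}\cup\{g\},\qquad g=\det M^{[n,n]},$$ and $\mathcal G_w$ is a Gröbner basis of $I_w$ with respect to every antidiagonal term order. Moreover there is a polynomial $g'\in R$ of degree $n$ with exactly $2^{n-1}$ terms such that, for every antidiagonal term order, the reduced Gröbner basis of $I_w$, which is unique up to multiplying its elements by nonzero scalars, is $$\mathcal G'_w=\{x_{ij}: i+j\le n-1\}\cup\{g'\}.$$ (A Gröbner basis is reduced if its elements are nonzero and the lead term of one element divides no term of another.) In particular, for every $d\ge 3$ there is a permutation $w$ for which the reduced Gröbner basis of $I_w$ has an element of degree $d$ with exactly $2^{d-1}$ terms, so the lower bound $2^{d-1}$ for the number of terms of an element of degree $d$ is sharp. -/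

import Mathlib

open MvPolynomial

namespace Schubert

noncomputable section

/-! Rows and columns are indexed by `Fin N`, so that the position `(i, j)` below is the
position `(i + 1, j + 1)` in the usual one-based indexing. -/

/-! ### Matrix Schubert varieties and Schubert determinantal ideals -/

/-- The orbit of the permutation matrix of `w` (with ones in the positions `(i, w i)`) under
`B₋ × B₊`, where `(x, y) • A = x A y⁻¹`. -/
def orbit (K : Type*) [Field K] {N : ℕ} (w : Equiv.Perm (Fin N)) :
    Set (Matrix (Fin N) (Fin N) K) :=
  {A | ∃ x y : GL (Fin N) K, x.val.IsLowerTriangular ∧ y.val.IsUpperTriangular ∧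
    A = x.val * w.permMatrix K * (y⁻¹).val}

/-- The matrix Schubert variety: the Zariski closure of the orbit in the affine space of
matrices over `K`, a matrix `A` being viewed as the point with coordinates `A i j`. -/
def matrixSchubertVariety (K : Type*) [Field K] {N : ℕ} (w : Equiv.Perm (Fin N)) :
    Set (Fin N × Fin N → K) :=
  zeroLocus K (vanishingIdeal K ((fun A p => A p.1 p.2) '' orbit K w))

/-- The Schubert determinantal ideal: the ideal of all polynomials with coefficients in `k` that
vanish on the matrix Schubert variety, whose points are taken in an extension field `K` of `k`
(`K = k` is allowed). -/
def schubertIdeal (k K : Type*) [Field k] [Field K] [Algebra k K] {N : ℕ}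
    (w : Equiv.Perm (Fin N)) : Ideal (MvPolynomial (Fin N × Fin N) k) :=
  vanishingIdeal k (matrixSchubertVariety K w)

/-! ### Elusive minors -/

/-- The minor of the generic `N × N` matrix of variables whose rows `I` and columns `J` are
enumerated increasingly by `r` and `c`. -/
def minor (k : Type*) [Field k] {N d : ℕ} (r c : Fin d ↪o Fin N) :
    MvPolynomial (Fin N × Fin N) k :=
  ((Matrix.mvPolynomialX (Fin N) (Fin N) k).submatrix r c).det

/-- The rank function: the number of ones weakly northwest of `(i, j)` in the permutation
matrix of `w`. -/
def rk {N : ℕ} (w : Equiv.Perm (Fin N)) (i j : Fin N) : ℕ :=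
  (Finset.univ.filter fun a : Fin N => a ≤ i ∧ w a ≤ j).card

/-- The Rothe diagram. -/
def rotheDiagram {N : ℕ} (w : Equiv.Perm (Fin N)) : Set (Fin N × Fin N) :=
  {p | p.2 < w p.1 ∧ p.1 < w.symm p.2}

/-- Fulton's essential set: the boxes of the Rothe diagram with no box of the diagram directly
below and none directly to the right. -/
def essentialSet {N : ℕ} (w : Equiv.Perm (Fin N)) : Set (Fin N × Fin N) :=
  {p | p ∈ rotheDiagram w ∧
    (∀ i' : Fin N, (i' : ℕ) = p.1 + 1 → (i', p.2) ∉ rotheDiagram w) ∧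
    (∀ j' : Fin N, (j' : ℕ) = p.2 + 1 → (p.1, j') ∉ rotheDiagram w)}

/-- For a set of `d` rows (or columns) enumerated by `r`, the number of those that are among the
rows (columns) up to and including `i`. -/
def countUpTo {N d : ℕ} (r : Fin d ↪o Fin N) (i : Fin N) : ℕ :=
  (Finset.univ.filter fun a : Fin d => r a ≤ i).card

/-- The minor of size `d` with rows `r` and columns `c` attends the northwest submatrix with
southeast corner `(i', j')`. -/
def Attends {N d : ℕ} (w : Equiv.Perm (Fin N)) (r c : Fin d ↪o Fin N) (i' j' : Fin N) : Prop :=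
  (rk w i' j' < countUpTo r i' ∧ countUpTo c j' = d) ∨
    (countUpTo r i' = d ∧ rk w i' j' < countUpTo c j')

/-- The set of elusive minors. A minor belongs to `(i, j)` in the essential set if it is of size
`rk w i j + 1` and lies in the northwest submatrix with southeast corner `(i, j)`; it is elusive
if it attends none of the northwest submatrices given by essential boxes of smaller rank. -/
def elusiveMinors (k : Type*) [Field k] {N : ℕ} (w : Equiv.Perm (Fin N)) :
    Set (MvPolynomial (Fin N × Fin N) k) :=
  {f | ∃ i j : Fin N, (i, j) ∈ essentialSet w ∧
    ∃ r c : Fin (rk w i j + 1) ↪o Fin N, (∀ a, r a ≤ i) ∧ (∀ a, c a ≤ j) ∧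
      (∀ i' j' : Fin N, (i', j') ∈ essentialSet w → rk w i' j' < rk w i j →
        ¬ Attends w r c i' j') ∧
      f = minor k r c}

/-! ### Gröbner bases -/

/-- A monomial order on the variables of the generic matrix is antidiagonal (over `k`) if the
lead term of every minor is its antidiagonal term. -/
def IsAntidiagonal (k : Type*) [Field k] {N : ℕ} (m : MonomialOrder (Fin N × Fin N)) : Prop :=
  ∀ (d : ℕ) (r c : Fin d ↪o Fin N),
    m.degree (minor k r c) = ∑ a : Fin d, Finsupp.single (r a, c a.rev) 1

/-- The initial ideal. -/
def initialIdeal {σ k : Type*} [Field k] (m : MonomialOrder σ) (I : Ideal (MvPolynomial σ k)) :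
    Ideal (MvPolynomial σ k) :=
  Ideal.span (m.leadingTerm '' (I : Set (MvPolynomial σ k)))

/-- Gröbner bases of an ideal with respect to a monomial order. -/
def IsGroebnerBasis {σ k : Type*} [Field k] (m : MonomialOrder σ) (I : Ideal (MvPolynomial σ k))
    (G : Set (MvPolynomial σ k)) : Prop :=
  G.Finite ∧ G ⊆ (I : Set (MvPolynomial σ k)) ∧
    Ideal.span (m.leadingTerm '' G) = initialIdeal m I

/-- Reduced Gröbner bases, without a normalization of the lead coefficients: the elements are
nonzero and the lead term of one divides no term of another. -/
def IsReducedGroebnerBasis {σ k : Type*} [Field k] (m : MonomialOrder σ)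
    (I : Ideal (MvPolynomial σ k)) (G : Set (MvPolynomial σ k)) : Prop :=
  IsGroebnerBasis m I G ∧ 0 ∉ G ∧
    ∀ g₁ ∈ G, ∀ g₂ ∈ G, g₁ ≠ g₂ →
      ∀ s ∈ g₂.support, ¬ m.leadingTerm g₁ ∣ monomial s (coeff s g₂)

/-- Two sets of polynomials agree up to multiplying each element by a nonzero scalar. -/
def EqUpToScalars {σ k : Type*} [Field k] (G G' : Set (MvPolynomial σ k)) : Prop :=
  ∃ c : MvPolynomial σ k → kˣ, G' = (fun g => (c g : k) • g) '' G

/-! ### The permutation `(n-1) (n-2) … 2 1 (n+1) n` -/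

/-- The one-line notation `(n-1) (n-2) … 2 1 (n+1) n`, shifted to start from zero: the values
`n-2, n-3, …, 1, 0, n, n-1` at the arguments `0, 1, …, n`. -/
def extremeFun (n : ℕ) (i : Fin (n + 1)) : Fin (n + 1) :=
  ⟨if (i : ℕ) + 1 < n then n - 2 - i else if (i : ℕ) + 1 = n then n else n - 1, by
    split_ifs <;> omega⟩

theorem extremeFun_involutive (n : ℕ) : Function.Involutive (extremeFun n) := by
  intro i
  have hi := i.isLt
  ext
  simp only [extremeFun]
  split_ifs <;> omega

/-- The permutation `(n-1) (n-2) … 2 1 (n+1) n` of `n + 1` letters. -/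
def extremePerm (n : ℕ) : Equiv.Perm (Fin (n + 1)) :=
  (extremeFun_involutive n).toPerm

/-- The variables `x_{ij}` with `i + j ≤ n - 1` in one-based indexing. -/
def cornerVars (k : Type*) [Field k] (n : ℕ) :
    Set (MvPolynomial (Fin (n + 1) × Fin (n + 1)) k) :=
  {f | ∃ i j : Fin (n + 1), ((i : ℕ) + 1) + ((j : ℕ) + 1) ≤ n - 1 ∧ f = X (i, j)}

/-- The determinant of the northwest `n × n` submatrix of the generic matrix of size `n + 1`. -/
def northwestDet (k : Type*) [Field k] (n : ℕ) :
    MvPolynomial (Fin (n + 1) × Fin (n + 1)) k :=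
  ((Matrix.mvPolynomialX (Fin (n + 1)) (Fin (n + 1)) k).submatrix
    Fin.castSucc Fin.castSucc).det

end

end Schubert

/-! Put `n = m + 1`. The permutation matrix is block diagonal, with an antidiagonal `m × m` block
followed by a `2 × 2` swap. Points of the orbit have zero entries in the northwest corner and
satisfy `g = 0`. Conversely, a matrix with zero corner and invertible northwest `m × m` block `U`
lies in the orbit as soon as its `2 × 2` Schur complement `S` has `S 0 0 = 0` and nonzero
off-diagonal entries (`mem_orbit_extremePerm`).

Let `g'` be `g` with the corner variables set to zero. It is linear in the pivot variable, the last
diagonal entry of the `n × n` block: `g' = a * z + b`, where `a` is, up to sign, the antidiagonal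
product of `U`. For `f` in the ideal, kill the corner variables and pseudo-divide by `g'`. The
remainder involves neither corner nor pivot and vanishes on the orbit. Generic values of all the
other entries extend to an orbit point by solving `S 0 0 = 0` for the pivot, so the remainder is
zero (`eq_zero_of_vanishes_on_orbit`). Since `g'` is coprime to `a`, it divides the reduction of `f`
(`reducedDet_dvd_killVars`). Hence every lead monomial of the ideal is divisible by a corner
variable or by the antidiagonal monomial, which is the lead monomial of both `g` and `g'`.

The terms of `g'` correspond to permutations avoiding the corner. After reversing the values these
satisfy `τ i ≤ i + 1`, and there are `2 ^ m` of them (`card_perm_le_succ`). -/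

namespace Schubert

/-! ### Gröbner bases and uniqueness of reduced ones -/

section Groebner

variable {σ k : Type*} [Field k] {m : MonomialOrder σ} {I : Ideal (MvPolynomial σ k)}
  {G G' : Set (MvPolynomial σ k)}

theorem exists_degree_le_of_leadingTerm_mem_span {f : MvPolynomial σ k} (hf : f ≠ 0)
    (h : m.leadingTerm f ∈ Ideal.span (m.leadingTerm '' G)) :
    ∃ g ∈ G, g ≠ 0 ∧ m.degree g ≤ m.degree f := by
  classical
  rw [m.span_leadingTerm_eq_span_monomial', ← Set.image_image (fun s => monomial s (1 : k)),
    mem_ideal_span_monomial_image] at h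
  obtain ⟨_, ⟨g, ⟨hg, hg0⟩, rfl⟩, hle⟩ := h (m.degree f) (by
    rw [m.support_leadingTerm' hf]; simp)
  exact ⟨g, hg, hg0, hle⟩

theorem leadingTerm_mem_span_of_degree_le {f g : MvPolynomial σ k} (hg : g ∈ G) (hg0 : g ≠ 0)
    (h : m.degree g ≤ m.degree f) : m.leadingTerm f ∈ Ideal.span (m.leadingTerm '' G) := by
  refine Ideal.mem_of_dvd _ ?_ (Ideal.subset_span (Set.mem_image_of_mem _ hg))
  rw [MonomialOrder.leadingTerm, MonomialOrder.leadingTerm, monomial_dvd_monomial]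
  exact ⟨Or.inr h, (m.leadingCoeff_ne_zero_iff.2 hg0).isUnit.dvd⟩

/-- A finite subset of an ideal is a Gröbner basis as soon as every lead monomial of the ideal is
divisible by a lead monomial of the subset. -/
theorem isGroebnerBasis_of_forall_exists_degree_le (hfin : G.Finite)
    (hsub : G ⊆ (I : Set (MvPolynomial σ k)))
    (h : ∀ f ∈ I, f ≠ 0 → ∃ g ∈ G, g ≠ 0 ∧ m.degree g ≤ m.degree f) :
    IsGroebnerBasis m I G := by
  refine ⟨hfin, hsub, le_antisymm (Ideal.span_mono (Set.image_mono hsub)) ?_⟩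
  refine Ideal.span_le.2 ?_
  rintro _ ⟨f, hf, rfl⟩
  rcases eq_or_ne f 0 with rfl | hf0
  · simp
  · obtain ⟨g, hg, hg0, hle⟩ := h f hf hf0
    exact leadingTerm_mem_span_of_degree_le hg hg0 hle

theorem IsGroebnerBasis.exists_degree_le (hG : IsGroebnerBasis m I G) {f : MvPolynomial σ k}
    (hf : f ∈ I) (hf0 : f ≠ 0) : ∃ g ∈ G, m.degree g ≤ m.degree f := by
  obtain ⟨g, hg, -, hle⟩ := exists_degree_le_of_leadingTerm_mem_span (m := m) (G := G) hf0 (by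
    rw [hG.2.2]; exact Ideal.subset_span (Set.mem_image_of_mem _ hf))
  exact ⟨g, hg, hle⟩

/-- In a reduced Gröbner basis, a lead monomial divides only monomials of its own element. -/
theorem IsReducedGroebnerBasis.eq_of_degree_le (hG : IsReducedGroebnerBasis m I G)
    {g₁ g₂ : MvPolynomial σ k} (h₁ : g₁ ∈ G) (h₂ : g₂ ∈ G) {s : σ →₀ ℕ} (hs : s ∈ g₂.support)
    (hle : m.degree g₁ ≤ s) : g₁ = g₂ := by
  by_contra hne
  refine hG.2.2 g₁ h₁ g₂ h₂ hne s hs ?_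
  rw [MonomialOrder.leadingTerm, monomial_dvd_monomial]
  have h0 : g₁ ≠ 0 := fun h => hG.2.1 (h ▸ h₁)
  exact ⟨Or.inr hle, (m.leadingCoeff_ne_zero_iff.2 h0).isUnit.dvd⟩

/-- Divide the lead monomial of `g` by one from `G'`, and that one by one from `G`. Reducedness
forces the return to `g`, so both divisions are equalities. -/
theorem IsReducedGroebnerBasis.exists_degree_eq (hG : IsReducedGroebnerBasis m I G)
    (hG' : IsReducedGroebnerBasis m I G') {g : MvPolynomial σ k} (hg : g ∈ G) :
    ∃ g' ∈ G', m.degree g' = m.degree g := by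
  have h0 : g ≠ 0 := fun h => hG.2.1 (h ▸ hg)
  obtain ⟨g', hg', hle⟩ := hG'.1.exists_degree_le (hG.1.2.1 hg) h0
  have h0' : g' ≠ 0 := fun h => hG'.2.1 (h ▸ hg')
  obtain ⟨g'', hg'', hle'⟩ := hG.1.exists_degree_le (hG'.1.2.1 hg') h0'
  have : g'' = g := hG.eq_of_degree_le hg'' hg (m.degree_mem_support h0) (hle'.trans hle)
  subst this
  exact ⟨g', hg', le_antisymm hle hle'⟩

theorem IsReducedGroebnerBasis.not_degree_le (hG : IsReducedGroebnerBasis m I G)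
    {g h : MvPolynomial σ k} (hg : g ∈ G) (hh : h ∈ G) {s : σ →₀ ℕ} (hs : s ∈ g.support)
    (hne : s ≠ m.degree g) : ¬ m.degree h ≤ s := by
  intro hle
  have := hG.eq_of_degree_le hh hg hs hle
  subst this
  exact hne (m.toSyn.injective (le_antisymm (m.le_degree hs) (m.toSyn_monotone hle)))

/-- The lead terms cancel in the difference. If it were nonzero, its lead monomial would be a
non-lead monomial of `g` or `g'` divisible by a lead monomial of the same basis, which
`not_degree_le` excludes. -/
theorem IsReducedGroebnerBasis.smul_eq_smul (hG : IsReducedGroebnerBasis m I G)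
    (hG' : IsReducedGroebnerBasis m I G') {g g' : MvPolynomial σ k} (hg : g ∈ G) (hg' : g' ∈ G')
    (hd : m.degree g' = m.degree g) : m.leadingCoeff g' • g = m.leadingCoeff g • g' := by
  classical
  rw [← sub_eq_zero]
  by_contra hne
  set p := m.leadingCoeff g' • g - m.leadingCoeff g • g' with hp
  have hpI : p ∈ I := I.sub_mem (Submodule.smul_of_tower_mem I _ (hG.1.2.1 hg))
    (Submodule.smul_of_tower_mem I _ (hG'.1.2.1 hg'))
  have hs := m.degree_mem_support hne
  have hsne : m.degree p ≠ m.degree g := by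
    intro h
    rw [h, mem_support_iff] at hs
    apply hs
    rw [hp, coeff_sub, coeff_smul, coeff_smul]
    nth_rewrite 2 [← hd]
    simp only [smul_eq_mul, MonomialOrder.leadingCoeff]
    ring
  obtain ⟨h, hh, hle⟩ := hG.1.exists_degree_le hpI hne
  obtain ⟨h', hh', hle'⟩ := hG'.1.exists_degree_le hpI hne
  rcases Finset.mem_union.1 (support_sub _ _ _ hs) with h1 | h1
  · exact hG.not_degree_le hg hh (support_smul h1) hsne hle
  · exact hG'.not_degree_le hg' hh' (support_smul h1) (hd ▸ hsne) hle'

/-- Reduced Gröbner bases are unique up to scalars. -/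
theorem IsReducedGroebnerBasis.eqUpToScalars (hG : IsReducedGroebnerBasis m I G)
    (hG' : IsReducedGroebnerBasis m I G') : EqUpToScalars G G' := by
  classical
  choose! φ hφ hφd using fun g (hg : g ∈ G) => hG.exists_degree_eq hG' hg
  have key : ∀ g ∈ G, ∃ c : kˣ, φ g = (c : k) • g := by
    intro g hg
    have h0 : m.leadingCoeff g ≠ 0 := m.leadingCoeff_ne_zero_iff.2 fun h => hG.2.1 (h ▸ hg)
    have h0' : m.leadingCoeff (φ g) ≠ 0 :=
      m.leadingCoeff_ne_zero_iff.2 fun h => hG'.2.1 (h ▸ hφ g hg)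
    have h := hG.smul_eq_smul hG' hg (hφ g hg) (hφd g hg)
    refine ⟨Units.mk0 _ (mul_ne_zero (inv_ne_zero h0) h0'), ?_⟩
    rw [Units.val_mk0, mul_smul, h, inv_smul_smul₀ h0]
  choose! c hc using key
  refine ⟨c, Set.ext fun g' => ⟨fun hg' => ?_, ?_⟩⟩
  · obtain ⟨g, hg, hd⟩ := hG'.exists_degree_eq hG hg'
    refine ⟨g, hg, ?_⟩
    have h0 : g' ≠ 0 := fun h => hG'.2.1 (h ▸ hg')
    change (c g : k) • g = g'
    rw [← hc g hg]
    exact hG'.eq_of_degree_le (hφ g hg) hg' (m.degree_mem_support h0) ((hφd g hg).trans hd).le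
  · rintro ⟨g, hg, rfl⟩
    change (c g : k) • g ∈ G'
    exact hc g hg ▸ hφ g hg

end Groebner

/-! ### Essential set, elusive minors, and the count of permutations -/

section Combinatorics

theorem extremePerm_apply_val (n : ℕ) (i : Fin (n + 1)) : (extremePerm n i : ℕ) =
    if (i : ℕ) + 1 < n then n - 2 - i else if (i : ℕ) + 1 = n then n else n - 1 := rfl

theorem extremePerm_symm (n : ℕ) : (extremePerm n).symm = extremePerm n :=
  (extremeFun_involutive n).toPerm_symm

theorem mem_rotheDiagram_extremePerm {n : ℕ} (p : Fin (n + 1) × Fin (n + 1)) :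
    p ∈ rotheDiagram (extremePerm n) ↔
      (p.1 : ℕ) + p.2 + 3 ≤ n ∨ ((p.1 : ℕ) + 1 = n ∧ (p.2 : ℕ) + 1 = n) := by
  have h1 := p.1.isLt
  have h2 := p.2.isLt
  simp only [rotheDiagram, extremePerm_symm, Set.mem_ofPred_eq, Fin.lt_def, extremePerm_apply_val]
  split_ifs <;> omega

theorem mem_essentialSet_extremePerm {n : ℕ} (p : Fin (n + 1) × Fin (n + 1)) :
    p ∈ essentialSet (extremePerm n) ↔
      (p.1 : ℕ) + p.2 + 3 = n ∨ ((p.1 : ℕ) + 1 = n ∧ (p.2 : ℕ) + 1 = n) := by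
  have h1 := p.1.isLt
  have h2 := p.2.isLt
  simp only [essentialSet, Set.mem_ofPred_eq, mem_rotheDiagram_extremePerm]
  constructor
  · rintro ⟨h, h3, -⟩
    rcases h with h | h
    · have := h3 ⟨p.1 + 1, by omega⟩ rfl
      simp only at this
      omega
    · exact Or.inr h
  · intro h
    refine ⟨by omega, fun i' hi' => by omega, fun j' hj' => by omega⟩

theorem rk_extremePerm_of_add_le {n : ℕ} {i j : Fin (n + 1)} (h : (i : ℕ) + j + 3 ≤ n) :
    rk (extremePerm n) i j = 0 := by
  rw [rk, Finset.card_eq_zero, Finset.filter_eq_empty_iff]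
  rintro a - ⟨ha, hb⟩
  rw [Fin.le_def] at ha hb
  rw [extremePerm_apply_val] at hb
  split_ifs at hb <;> omega

theorem rk_extremePerm_corner {n : ℕ} {i j : Fin (n + 1)} (hi : (i : ℕ) + 1 = n)
    (hj : (j : ℕ) + 1 = n) : rk (extremePerm n) i j + 1 = n := by
  have : rk (extremePerm n) i j = (Finset.univ.filter fun a : Fin (n + 1) => a < i).card := by
    rw [rk]
    congr 1
    ext a
    simp only [Finset.mem_filter, Finset.mem_univ, true_and, Fin.le_def, Fin.lt_def,
      extremePerm_apply_val]
    split_ifs <;> omega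
  rw [this, Finset.filter_gt_eq_Iio, Fin.card_Iio, hi]

/-- A strictly increasing self-map of `Fin n` is the identity; hence the corner box of rank `n - 1`
contributes a single minor. -/
theorem orderEmb_eq_castSucc {n : ℕ} (r : Fin n ↪o Fin (n + 1)) (h : ∀ a, (r a : ℕ) < n)
    (a : Fin n) : r a = a.castSucc := by
  have hs : StrictMono fun a => (⟨r a, h a⟩ : Fin n) := fun _ _ hab => r.strictMono hab
  have := (hs.range_inj strictMono_id).1 (by
    rw [Set.range_id, (Finite.surjective_of_injective hs.injective).range_eq])
  have ha : (⟨r a, h a⟩ : Fin n) = a := congrFun this a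
  exact Fin.ext (Fin.ext_iff.1 ha :)

theorem minor_one (k : Type*) [Field k] {N : ℕ} (r c : Fin 1 ↪o Fin N) :
    minor k r c = X (r 0, c 0) := by
  simp [minor, Matrix.mvPolynomialX_apply]

theorem minor_castSucc (k : Type*) [Field k] {n : ℕ} (r c : Fin n ↪o Fin (n + 1))
    (hr : ∀ a, r a = a.castSucc) (hc : ∀ a, c a = a.castSucc) :
    minor k r c = northwestDet k n := by
  rw [minor, northwestDet, show (r : Fin n → Fin (n + 1)) = Fin.castSucc from funext hr,
    show (c : Fin n → Fin (n + 1)) = Fin.castSucc from funext hc]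

theorem elusiveMinors_extremePerm (k : Type*) [Field k] {n : ℕ} (hn : 3 ≤ n) :
    elusiveMinors k (extremePerm n) = cornerVars k n ∪ {northwestDet k n} := by
  ext f
  constructor
  · rintro ⟨i, j, hij, r, c, hr, hc, -, rfl⟩
    rcases (mem_essentialSet_extremePerm _).1 hij with h | ⟨hi, hj⟩
    · simp only at h
      left
      have h0 := rk_extremePerm_of_add_le h.le
      revert r c
      rw [h0]
      intro r c hr hc
      refine ⟨r 0, c 0, ?_, minor_one k r c⟩
      have := Fin.le_def.1 (hr 0)
      have := Fin.le_def.1 (hc 0)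
      omega
    · simp only at hi hj
      right
      have h0 := rk_extremePerm_corner hi hj
      revert r c
      rw [h0]
      intro r c hr hc
      exact minor_castSucc k r c
        (orderEmb_eq_castSucc r fun a => by have := Fin.le_def.1 (hr a); omega)
        (orderEmb_eq_castSucc c fun a => by have := Fin.le_def.1 (hc a); omega)
  · rintro (⟨i, j, hij, rfl⟩ | hf)
    · let i' : Fin (n + 1) := ⟨n - 3 - j, by omega⟩
      have hsum : (i' : ℕ) + j + 3 = n := by simp only [i']; omega
      refine ⟨i', j, (mem_essentialSet_extremePerm _).2 (Or.inl hsum), ?_⟩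
      rw [rk_extremePerm_of_add_le hsum.le]
      have : Subsingleton (Fin (0 + 1)) := inferInstanceAs (Subsingleton (Fin 1))
      refine ⟨OrderEmbedding.ofStrictMono (fun _ => i) (Subsingleton.strictMono _),
        OrderEmbedding.ofStrictMono (fun _ => j) (Subsingleton.strictMono _), fun _ => ?_,
        fun _ => le_rfl, fun _ _ _ h => absurd h (Nat.not_lt_zero _), ?_⟩
      · simp only [OrderEmbedding.coe_ofStrictMono, Fin.le_def]
        omega
      · rw [minor_one]; rfl
    · rw [Set.mem_singleton_iff] at hf
      subst hf
      let i : Fin (n + 1) := ⟨n - 1, by omega⟩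
      have hi : (i : ℕ) + 1 = n := by simp only [i]; omega
      have h0 := rk_extremePerm_corner hi hi
      refine ⟨i, i, (mem_essentialSet_extremePerm _).2 (Or.inr ⟨hi, hi⟩), ?_⟩
      rw [show rk (extremePerm n) i i = n - 1 by omega]
      obtain ⟨d, rfl⟩ : ∃ d, n = d + 1 := ⟨n - 1, by omega⟩
      simp only [Nat.add_sub_cancel]
      -- Attending a box of rank zero would need all rows or all columns of the minor to stop before
      -- index `d`, but index `d` is used in both.
      have hcount : ∀ i' : Fin (d + 1 + 1), (i' : ℕ) < d →
          countUpTo (Fin.castSuccOrderEmb : Fin (d + 1) ↪o Fin (d + 1 + 1)) i' ≠ d + 1 := by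
        intro i' hi' h
        rw [countUpTo] at h
        have hle : (Finset.univ.filter fun a : Fin (d + 1) => Fin.castSuccOrderEmb a ≤ i') =
            Finset.univ := by
          rw [← Finset.card_eq_iff_eq_univ, h, Fintype.card_fin]
        have := (Finset.mem_filter.1 (hle ▸ Finset.mem_univ (Fin.last d))).2
        rw [Fin.le_def] at this
        simp at this
        omega
      refine ⟨Fin.castSuccOrderEmb, Fin.castSuccOrderEmb, fun a => ?_, fun a => ?_, ?_, ?_⟩
      · exact Fin.le_def.2 (by change (a : ℕ) ≤ i; omega)
      · exact Fin.le_def.2 (by change (a : ℕ) ≤ i; omega)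
      · intro i' j' hij' hlt hatt
        rcases (mem_essentialSet_extremePerm _).1 hij' with h | ⟨hi', hj'⟩
        · simp only at h
          rcases hatt with hatt | hatt
          · exact hcount j' (by omega) hatt.2
          · exact hcount i' (by omega) hatt.1
        · have := rk_extremePerm_corner hi' hj'
          simp only at this
          omega
      · exact (minor_castSucc k _ _ (fun _ => rfl) fun _ => rfl).symm

theorem forall_decomposeFin_symm_le_iff {n : ℕ} (p : Fin (n + 2)) (e : Equiv.Perm (Fin (n + 1))) :
    (∀ i, (Equiv.Perm.decomposeFin.symm (p, e) i : ℕ) ≤ i + 1) ↔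
      (p : ℕ) ≤ 1 ∧ ∀ i, (e i : ℕ) ≤ i + 1 := by
  rw [Fin.forall_fin_succ]
  simp only [Equiv.Perm.decomposeFin_symm_apply_zero, Equiv.Perm.decomposeFin_symm_apply_succ,
    Fin.val_zero, zero_add, Fin.val_succ]
  refine and_congr_right fun hp => forall_congr' fun i => ?_
  have hp' : p = 0 ∨ p = 1 := by
    rcases Nat.le_one_iff_eq_zero_or_eq_one.1 hp with h | h
    · exact Or.inl (Fin.ext h)
    · exact Or.inr (Fin.ext (by simpa using h))
  rcases hp' with rfl | rfl
  · simp
  · rw [Equiv.swap_apply_def, if_neg (Fin.succ_ne_zero _)]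
    -- The swap of `0` and `1` only turns a value `1` into `0`, which occurs when `e i = 0`; the
    -- bound holds on both sides in that case.
    split_ifs with h
    · have : e i = 0 := by
        rw [← Fin.succ_zero_eq_one] at h
        exact Fin.succ_injective _ h
      simp [this]
    · simp

/-- There are `2 ^ n` permutations `τ` of `n + 1` letters with `τ i ≤ i + 1` for all `i`. -/
theorem card_perm_le_succ (n : ℕ) :
    (Finset.univ.filter fun τ : Equiv.Perm (Fin (n + 1)) =>
      ∀ i, (τ i : ℕ) ≤ i + 1).card = 2 ^ n := by
  induction n with
  | zero => simp
  | succ n ih =>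
    have h := Finset.card_bij (s := Finset.univ.filter fun τ : Equiv.Perm (Fin (n + 2)) =>
      ∀ i, (τ i : ℕ) ≤ i + 1)
      (t := (Finset.univ.filter fun p : Fin (n + 2) => (p : ℕ) ≤ 1) ×ˢ
        Finset.univ.filter fun τ : Equiv.Perm (Fin (n + 1)) => ∀ i, (τ i : ℕ) ≤ i + 1)
      (fun τ _ => Equiv.Perm.decomposeFin τ) (fun τ hτ => by
        have := forall_decomposeFin_symm_le_iff (Equiv.Perm.decomposeFin τ).1
          (Equiv.Perm.decomposeFin τ).2
        rw [Prod.mk.eta, Equiv.symm_apply_apply] at this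
        simpa [this] using hτ)
      (fun _ _ _ _ h => Equiv.Perm.decomposeFin.injective h)
      (fun q hq => ⟨Equiv.Perm.decomposeFin.symm q, by
        simpa [forall_decomposeFin_symm_le_iff q.1 q.2] using hq, by simp⟩)
    rw [h, Finset.card_product, ih, pow_succ, mul_comm]
    congr 1
    rw [show (Finset.univ.filter fun p : Fin (n + 2) => (p : ℕ) ≤ 1) = {0, 1} by
      ext p
      simp only [Finset.mem_filter, Finset.mem_univ, true_and, Finset.mem_insert,
        Finset.mem_singleton, Fin.ext_iff, Fin.val_zero, Fin.val_one]
      omega]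
    rfl

end Combinatorics

/-! ### The orbit described by a Schur complement -/

section Orbit

/-- The enumeration of the first `m` indices followed by the index `m + a`. -/
def bordered (m : ℕ) (a : Fin 2) : Fin (m + 1) → Fin (m + 2) :=
  Fin.append (Fin.castAdd 2) fun _ : Fin 1 => Fin.natAdd m a

theorem permMatrix_apply {K : Type*} [Zero K] [One K] {N : ℕ} (w : Equiv.Perm (Fin N))
    (i j : Fin N) : w.permMatrix K i j = if w i = j then 1 else 0 := by
  simp [Equiv.Perm.permMatrix, PEquiv.toMatrix_apply, Equiv.toPEquiv_apply, eq_comm]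

variable {K : Type*} [Field K] {m : ℕ}

/-- The Schur complement of the northwest `m × m` block of a matrix of size `m + 2`. -/
noncomputable def schurComplement (A : Matrix (Fin (m + 2)) (Fin (m + 2)) K) :
    Matrix (Fin 2) (Fin 2) K :=
  A.submatrix (Fin.natAdd m) (Fin.natAdd m) - A.submatrix (Fin.natAdd m) (Fin.castAdd 2) *
    (A.submatrix (Fin.castAdd 2) (Fin.castAdd 2))⁻¹ *
      A.submatrix (Fin.castAdd 2) (Fin.natAdd m)

/-- Turns the conditions on Schur complement entries into polynomial conditions on `A`. -/
theorem det_submatrix_bordered (A : Matrix (Fin (m + 2)) (Fin (m + 2)) K) (a b : Fin 2)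
    (hU : (A.submatrix (Fin.castAdd 2) (Fin.castAdd 2)).det ≠ 0) :
    (A.submatrix (bordered m a) (bordered m b)).det =
      (A.submatrix (Fin.castAdd 2) (Fin.castAdd 2)).det * schurComplement A a b := by
  let := Matrix.invertibleOfIsUnitDet _ hU.isUnit
  rw [← Matrix.det_submatrix_equiv_self (finSumFinEquiv : Fin m ⊕ Fin 1 ≃ Fin (m + 1)),
    show ((A.submatrix (bordered m a) (bordered m b)).submatrix
        (finSumFinEquiv : Fin m ⊕ Fin 1 ≃ Fin (m + 1)) finSumFinEquiv) =
      Matrix.fromBlocks (A.submatrix (Fin.castAdd 2) (Fin.castAdd 2))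
        (A.submatrix (Fin.castAdd 2) fun _ => Fin.natAdd m b)
        (A.submatrix (fun _ => Fin.natAdd m a) (Fin.castAdd 2))
        (A.submatrix (fun _ => Fin.natAdd m a) fun _ => Fin.natAdd m b) by
      ext (i | i) (j | j) <;> simp [bordered],
    Matrix.det_fromBlocks₁₁, Matrix.det_fin_one, Matrix.invOf_eq_nonsing_inv]
  rfl

theorem submatrix_permMatrix_extremePerm (m : ℕ) :
    ((extremePerm (m + 1)).permMatrix K).submatrix (finSumFinEquiv : Fin m ⊕ Fin 2 ≃ _)
      (finSumFinEquiv : Fin m ⊕ Fin 2 ≃ _) =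
      Matrix.fromBlocks ((Fin.revPerm : Equiv.Perm (Fin m)).permMatrix K) 0 0 !![0, 1; 1, 0] := by
  ext (i | i) (j | j)
  · have := i.isLt
    simp only [Matrix.submatrix_apply, permMatrix_apply, finSumFinEquiv_apply_left,
      Matrix.fromBlocks_apply₁₁, Fin.ext_iff, extremePerm_apply_val, Fin.val_castAdd,
      Fin.revPerm_apply, Fin.val_rev]
    refine if_congr ?_ rfl rfl
    split_ifs <;> omega
  · have := i.isLt
    simp only [Matrix.submatrix_apply, permMatrix_apply, finSumFinEquiv_apply_left,
      finSumFinEquiv_apply_right, Matrix.fromBlocks_apply₁₂, Fin.ext_iff, extremePerm_apply_val,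
      Fin.val_castAdd, Fin.val_natAdd, Matrix.zero_apply]
    exact if_neg (by split_ifs <;> omega)
  · have := j.isLt
    simp only [Matrix.submatrix_apply, permMatrix_apply, finSumFinEquiv_apply_left,
      finSumFinEquiv_apply_right, Matrix.fromBlocks_apply₂₁, Fin.ext_iff, extremePerm_apply_val,
      Fin.val_castAdd, Fin.val_natAdd, Matrix.zero_apply]
    exact if_neg (by split_ifs <;> omega)
  · simp only [Matrix.submatrix_apply, permMatrix_apply,
      finSumFinEquiv_apply_right, Matrix.fromBlocks_apply₂₂, Fin.ext_iff, extremePerm_apply_val,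
      Fin.val_natAdd]
    fin_cases i <;> fin_cases j <;> simp

theorem submatrix_rev_mul_permMatrix {ι : Type*} (M : Matrix ι (Fin m) K) :
    M.submatrix id Fin.rev * (Fin.revPerm : Equiv.Perm (Fin m)).permMatrix K = M := by
  ext i j
  simp only [Matrix.mul_apply, Matrix.submatrix_apply, id, permMatrix_apply, Fin.revPerm_apply,
    Fin.rev_eq_iff, mul_ite, mul_one, mul_zero, Finset.sum_ite_eq', Finset.mem_univ, if_true,
    Fin.rev_rev]

theorem det_submatrix_rev (M : Matrix (Fin m) (Fin m) K) :
    (M.submatrix id Fin.rev).det = Equiv.Perm.sign (Fin.revPerm : Equiv.Perm (Fin m)) * M.det :=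
  Matrix.det_permute' Fin.revPerm M

theorem fromBlocks_isLowerTriangular {L : Matrix (Fin m) (Fin m) K} (hL : L.IsLowerTriangular)
    (C : Matrix (Fin 2) (Fin m) K) {x : Matrix (Fin 2) (Fin 2) K} (hx : x.IsLowerTriangular) :
    ((Matrix.fromBlocks L 0 C x).submatrix (finSumFinEquiv : Fin m ⊕ Fin 2 ≃ _).symm
      finSumFinEquiv.symm).IsLowerTriangular := by
  intro i j hij
  rw [OrderDual.toDual_lt_toDual] at hij
  induction i using Fin.addCases with
  | left i =>
    induction j using Fin.addCases with
    | left j => simpa using hL (OrderDual.toDual_lt_toDual.2 (Fin.lt_def.2 (Fin.lt_def.1 hij)))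
    | right j => simp
  | right i =>
    induction j using Fin.addCases with
    | left j =>
      have := j.isLt
      simp only [Fin.lt_def, Fin.val_natAdd, Fin.val_castAdd] at hij
      omega
    | right j => simpa using hx (OrderDual.toDual_lt_toDual.2 (by simpa using hij))

theorem fromBlocks_one_isUpperTriangular (V : Matrix (Fin m) (Fin 2) K) :
    ((Matrix.fromBlocks 1 V 0 1).submatrix (finSumFinEquiv : Fin m ⊕ Fin 2 ≃ _).symm
      finSumFinEquiv.symm).IsUpperTriangular := by
  intro i j hij
  simp only [id] at hij
  induction i using Fin.addCases with
  | left i =>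
    induction j using Fin.addCases with
    | left j =>
      have : i ≠ j := by rintro rfl; exact lt_irrefl _ hij
      simp [this]
    | right j =>
      have := i.isLt
      simp only [Fin.lt_def, Fin.val_natAdd, Fin.val_castAdd] at hij
      omega
  | right i =>
    induction j using Fin.addCases with
    | left j => simp
    | right j =>
      have : i ≠ j := by rintro rfl; exact lt_irrefl _ hij
      simp [this]

/-- Sufficient conditions for a matrix to lie in the orbit of the extreme permutation. -/
theorem mem_orbit_extremePerm (A : Matrix (Fin (m + 2)) (Fin (m + 2)) K)
    (hA : ∀ i j : Fin (m + 2), (i : ℕ) + j + 2 ≤ m → A i j = 0)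
    (hU : (A.submatrix (Fin.castAdd 2) (Fin.castAdd 2)).det ≠ 0)
    (h00 : schurComplement A 0 0 = 0) (h01 : schurComplement A 0 1 ≠ 0)
    (h10 : schurComplement A 1 0 ≠ 0) : A ∈ orbit K (extremePerm (m + 1)) := by
  set U := A.submatrix (Fin.castAdd 2) (Fin.castAdd 2) with hUdef
  set C := A.submatrix (Fin.natAdd m) (Fin.castAdd 2) with hC
  set V := A.submatrix (Fin.castAdd 2) (Fin.natAdd m) with hV
  set S := schurComplement A with hS
  have hUV : U * (U⁻¹ * V) = V := Matrix.mul_nonsing_inv_cancel_left _ _ hU.isUnit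
  -- The factorization is `x = [L, 0; C·rev, s]` and `y⁻¹ = [1, U⁻¹V; 0, 1]`. Reversing the columns
  -- of `U` makes it lower triangular because the corner vanishes, and `s` times the swap is `S`
  -- because `S 0 0 = 0`.
  let L := U.submatrix id Fin.rev
  let s : Matrix (Fin 2) (Fin 2) K := !![S 0 1, 0; S 1 1, S 1 0]
  let e : Fin m ⊕ Fin 2 ≃ Fin (m + 2) := finSumFinEquiv
  have hL : L.IsLowerTriangular := by
    intro i j hij
    rw [OrderDual.toDual_lt_toDual, Fin.lt_def] at hij
    refine hA _ _ ?_
    simp only [Fin.val_castAdd, Fin.val_rev, id]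
    omega
  have hs : s.IsLowerTriangular := by
    intro i j hij
    rw [OrderDual.toDual_lt_toDual] at hij
    fin_cases i <;> fin_cases j <;> simp_all [s]
  let x := (Matrix.fromBlocks L 0 (C.submatrix id Fin.rev) s).submatrix e.symm e.symm
  have hxdet : x.det ≠ 0 := by
    rw [Matrix.det_submatrix_equiv_self, Matrix.det_fromBlocks_zero₁₂, det_submatrix_rev]
    refine mul_ne_zero (mul_ne_zero ?_ hU) ?_
    · rcases Int.units_eq_one_or (Equiv.Perm.sign (Fin.revPerm : Equiv.Perm (Fin m))) with h | h <;>
        simp [h]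
    · simpa [s, Matrix.det_fin_two] using ⟨h01, h10⟩
  let y : GL (Fin (m + 2)) K :=
    ⟨(Matrix.fromBlocks 1 (-(U⁻¹ * V)) 0 1).submatrix e.symm e.symm,
      (Matrix.fromBlocks 1 (U⁻¹ * V) 0 1).submatrix e.symm e.symm, by
        rw [Matrix.submatrix_mul_equiv, Matrix.fromBlocks_multiply]; simp, by
        rw [Matrix.submatrix_mul_equiv, Matrix.fromBlocks_multiply]; simp⟩
  refine ⟨Matrix.GeneralLinearGroup.mkOfDetNeZero x hxdet, y,
    fromBlocks_isLowerTriangular hL _ hs, fromBlocks_one_isUpperTriangular _, ?_⟩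
  have hP : (extremePerm (m + 1)).permMatrix K =
      (Matrix.fromBlocks ((Fin.revPerm : Equiv.Perm (Fin m)).permMatrix K) 0 0
        !![0, 1; 1, 0]).submatrix e.symm e.symm := by
    rw [← submatrix_permMatrix_extremePerm, Matrix.submatrix_submatrix]; simp [e]
  change A = x * (extremePerm (m + 1)).permMatrix K *
    (Matrix.fromBlocks 1 (U⁻¹ * V) 0 1).submatrix e.symm e.symm
  rw [hP, Matrix.submatrix_mul_equiv, Matrix.submatrix_mul_equiv, Matrix.fromBlocks_multiply,
    Matrix.fromBlocks_multiply]
  simp only [L, submatrix_rev_mul_permMatrix, Matrix.mul_zero, Matrix.zero_mul, add_zero, zero_add,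
    Matrix.mul_one, hUV]
  have hsS : s * !![0, 1; 1, 0] = S := by
    ext i j
    fin_cases i <;> fin_cases j <;> simp [s, Matrix.mul_apply, Fin.sum_univ_two, h00]
  have hE : C * (U⁻¹ * V) + S = A.submatrix (Fin.natAdd m) (Fin.natAdd m) := by
    rw [hS, schurComplement, ← Matrix.mul_assoc]
    abel
  rw [hsS, hE]
  ext i j
  induction i using Fin.addCases <;> induction j using Fin.addCases <;> simp [e, U, V, C]

/-- Matrices in the orbit of the extreme permutation vanish in the northwest corner. -/
theorem apply_eq_zero_of_mem_orbit {A : Matrix (Fin (m + 2)) (Fin (m + 2)) K}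
    (hA : A ∈ orbit K (extremePerm (m + 1))) {i j : Fin (m + 2)} (hij : (i : ℕ) + j + 2 ≤ m) :
    A i j = 0 := by
  obtain ⟨x, y, hx, hy, rfl⟩ := hA
  let : Invertible y.val := y.invertible
  have hy' : (y⁻¹).val.IsUpperTriangular := by
    have := Matrix.blockTriangular_inv_of_blockTriangular (M := y.val) hy
    rwa [← Matrix.coe_units_inv] at this
  rw [Matrix.mul_apply]
  refine Finset.sum_eq_zero fun b _ => ?_
  rw [Matrix.mul_apply, Finset.sum_mul]
  refine Finset.sum_eq_zero fun a _ => ?_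
  by_cases ha : i < a
  · rw [hx (OrderDual.toDual_lt_toDual.2 ha)]; simp
  by_cases hb : j < b
  · rw [hy' (by simpa using hb)]; simp
  rw [permMatrix_apply, if_neg]
  · simp
  · rw [Fin.lt_def, not_lt] at ha hb
    rw [Fin.ext_iff, extremePerm_apply_val]
    split_ifs <;> omega

/-- The northwest minor of codimension one vanishes on the orbit of the extreme permutation. -/
theorem det_submatrix_castSucc_of_mem_orbit {A : Matrix (Fin (m + 2)) (Fin (m + 2)) K}
    (hA : A ∈ orbit K (extremePerm (m + 1))) :
    (A.submatrix Fin.castSucc Fin.castSucc).det = 0 := by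
  obtain ⟨x, y, hx, hy, rfl⟩ := hA
  let : Invertible y.val := y.invertible
  have hy' : (y⁻¹).val.IsUpperTriangular := by
    have := Matrix.blockTriangular_inv_of_blockTriangular (M := y.val) hy
    rwa [← Matrix.coe_units_inv] at this
  -- Triangularity makes northwest truncation compatible with the product.
  have : (x.val * (extremePerm (m + 1)).permMatrix K * (y⁻¹).val).submatrix Fin.castSucc
        Fin.castSucc =
      x.val.submatrix Fin.castSucc Fin.castSucc *
        ((extremePerm (m + 1)).permMatrix K).submatrix Fin.castSucc Fin.castSucc *
          (y⁻¹).val.submatrix Fin.castSucc Fin.castSucc := by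
    ext i j
    simp only [Matrix.submatrix_apply, Matrix.mul_apply]
    rw [Fin.sum_univ_castSucc, hy' (by simp), mul_zero, add_zero]
    refine Finset.sum_congr rfl fun b _ => ?_
    rw [Fin.sum_univ_castSucc,
      hx (OrderDual.toDual_lt_toDual.2 (Fin.castSucc_lt_last i)), zero_mul, add_zero]
  -- The one in row `m` of the permutation matrix sits in column `m + 1`, which the truncation
  -- drops.
  rw [this, Matrix.det_mul, Matrix.det_mul,
    Matrix.det_eq_zero_of_row_eq_zero (A := ((extremePerm (m + 1)).permMatrix K).submatrix _ _)
      (Fin.last m), mul_zero, zero_mul]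
  intro j
  rw [Matrix.submatrix_apply, permMatrix_apply, if_neg]
  have := j.isLt
  rw [Fin.ext_iff, extremePerm_apply_val]
  simp only [Fin.val_castSucc, Fin.val_last]
  split_ifs <;> omega

end Orbit

/-! ### Setting variables to zero and pseudo-division -/

section KillVars

variable {σ k : Type*} [Field k]

open Classical in
/-- The substitution of zero for the variables in `s`. -/
noncomputable def killVars (k : Type*) [Field k] (s : Set σ) :
    MvPolynomial σ k →ₐ[k] MvPolynomial σ k :=
  aeval fun p => if p ∈ s then 0 else X p

theorem killVars_X_of_mem {s : Set σ} {p : σ} (hp : p ∈ s) : killVars k s (X p) = 0 := by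
  rw [killVars, aeval_X, if_pos hp]

theorem killVars_X_of_notMem {s : Set σ} {p : σ} (hp : p ∉ s) : killVars k s (X p) = X p := by
  rw [killVars, aeval_X, if_neg hp]

theorem killVars_monomial_of_mem {s : Set σ} {d : σ →₀ ℕ} (c : k) {p : σ} (hp : p ∈ s)
    (hd : d p ≠ 0) : killVars k s (monomial d c) = 0 := by
  rw [killVars, aeval_monomial, Finsupp.prod,
    Finset.prod_eq_zero (Finsupp.mem_support_iff.2 hd) (by rw [if_pos hp, zero_pow hd]), mul_zero]

theorem killVars_monomial_of_forall {s : Set σ} {d : σ →₀ ℕ} (c : k) (hd : ∀ p ∈ s, d p = 0) :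
    killVars k s (monomial d c) = monomial d c := by
  rw [killVars, aeval_monomial, monomial_eq, algebraMap_eq]
  congr 1
  refine Finsupp.prod_congr fun p hp => ?_
  rw [if_neg fun h => Finsupp.mem_support_iff.1 hp (hd p h)]

open Classical in
theorem coeff_killVars (s : Set σ) (f : MvPolynomial σ k) (d : σ →₀ ℕ) :
    coeff d (killVars k s f) = if ∀ p ∈ s, d p = 0 then coeff d f else 0 := by
  induction f using MvPolynomial.induction_on' with
  | add f g hf hg =>
    rw [map_add, coeff_add, hf, hg, coeff_add]
    split_ifs <;> simp
  | monomial e c =>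
    by_cases he : ∀ p ∈ s, e p = 0
    · rw [killVars_monomial_of_forall c he, coeff_monomial]
      split_ifs with h1 h2 h2
      · rfl
      · exact absurd (h1 ▸ he) h2
      · rfl
      · rfl
    · push Not at he
      obtain ⟨p, hp, hep⟩ := he
      rw [killVars_monomial_of_mem c hp hep, coeff_zero, coeff_monomial]
      split_ifs with h1 h2
      · exact absurd (h1 p hp) (h2 ▸ hep)
      · rfl
      · rfl

theorem mem_support_killVars {s : Set σ} {f : MvPolynomial σ k} {d : σ →₀ ℕ} :
    d ∈ (killVars k s f).support ↔ (∀ p ∈ s, d p = 0) ∧ d ∈ f.support := by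
  classical
  rw [mem_support_iff, coeff_killVars, mem_support_iff]
  split_ifs with h
  · exact (and_iff_right h).symm
  · simp [h]

theorem aeval_killVars {K : Type*} [Field K] [Algebra k K] {s : Set σ} {t u : σ → K}
    (hs : ∀ p ∈ s, u p = 0) (ht : ∀ p ∉ s, u p = t p) (f : MvPolynomial σ k) :
    aeval t (killVars k s f) = aeval u f := by
  induction f using MvPolynomial.induction_on with
  | C c => simp [killVars]
  | add f g hf hg => simp only [map_add, hf, hg]
  | mul_X f p hf =>
    rw [map_mul, map_mul, map_mul, hf, aeval_X]
    by_cases hp : p ∈ s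
    · rw [killVars_X_of_mem hp, map_zero, hs p hp]
    · rw [killVars_X_of_notMem hp, aeval_X, ht p hp]

/-- Pseudo-division by a polynomial `a * X z + b` that is linear in the variable `z`. -/
theorem exists_pow_mul_killVars_eq (s : Set σ) (z : σ) {a b : MvPolynomial σ k}
    (ha : a ∈ supported k {p | p ∉ s ∧ p ≠ z}) (hb : b ∈ supported k {p | p ∉ s ∧ p ≠ z})
    (f : MvPolynomial σ k) : ∃ (e : ℕ) (q r : MvPolynomial σ k),
      r ∈ supported k {p | p ∉ s ∧ p ≠ z} ∧
        a ^ e * killVars k s f = q * (a * X z + b) + r := by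
  induction f using MvPolynomial.induction_on with
  | C c => exact ⟨0, 0, C c, Subalgebra.algebraMap_mem _ c, by simp [killVars]⟩
  | add f g hf hg =>
    obtain ⟨e, q, r, hr, h⟩ := hf
    obtain ⟨e', q', r', hr', h'⟩ := hg
    refine ⟨e + e', a ^ e' * q + a ^ e * q', a ^ e' * r + a ^ e * r',
      add_mem (mul_mem (pow_mem ha _) hr) (mul_mem (pow_mem ha _) hr'), ?_⟩
    rw [map_add]
    linear_combination a ^ e' * h + a ^ e * h'
  | mul_X f p hf =>
    obtain ⟨e, q, r, hr, h⟩ := hf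
    rw [map_mul]
    by_cases hp : p ∈ s
    · exact ⟨0, 0, 0, zero_mem _, by rw [killVars_X_of_mem hp]; simp⟩
    rw [killVars_X_of_notMem hp]
    by_cases hz : p = z
    · subst hz
      -- One more factor `a` lets `a * z * r` be rewritten as `r * (a * z + b) - b * r`, removing
      -- `z` from the remainder.
      refine ⟨e + 1, a * X p * q + r, -(b * r), neg_mem (mul_mem hb hr), ?_⟩
      linear_combination a * X p * h
    · refine ⟨e, q * X p, r * X p, mul_mem hr (X_mem_supported.2 ⟨hp, hz⟩), ?_⟩
      linear_combination X p * h

theorem aeval_congr_of_mem_supported {K : Type*} [Field K] [Algebra k K] {T : Set σ}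
    {r : MvPolynomial σ k} (hr : r ∈ supported k T) {t u : σ → K} (h : ∀ p ∈ T, t p = u p) :
    aeval t r = aeval u r := by
  rw [mem_supported] at hr
  exact eval₂Hom_congr' rfl (fun p hp _ => h p (hr hp)) rfl

theorem det_mem {R A ι : Type*} [CommRing R] [CommRing A] [Algebra R A] [Fintype ι]
    [DecidableEq ι] (S : Subalgebra R A) (M : Matrix ι ι A) (h : ∀ i j, M i j ∈ S) :
    M.det ∈ S := by
  rw [Matrix.det_apply]
  refine sum_mem fun τ _ => ?_
  rw [Units.smul_def]
  exact zsmul_mem (prod_mem fun i _ => h _ _) _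

end KillVars

/-! ### The ideal and generic points of the orbit -/

section Ideal

/-- Passing to the Zariski closure over `K` adds no condition, since `f` can be regarded as a
polynomial over `K`. -/
theorem mem_schubertIdeal_iff {k K : Type*} [Field k] [Field K] [Algebra k K] {N : ℕ}
    {w : Equiv.Perm (Fin N)} {f : MvPolynomial (Fin N × Fin N) k} :
    f ∈ schubertIdeal k K w ↔ ∀ A ∈ orbit K w, aeval (fun p => A p.1 p.2) f = 0 := by
  rw [schubertIdeal, mem_vanishingIdeal_iff]
  constructor
  · intro h A hA
    exact h _ (zeroLocus_vanishingIdeal_le _ (Set.mem_image_of_mem _ hA))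
  · intro h x hx
    have hf : map (algebraMap k K) f ∈
        vanishingIdeal K ((fun A p => A p.1 p.2) '' orbit K w) := by
      rw [mem_vanishingIdeal_iff]
      rintro _ ⟨A, hA, rfl⟩
      rw [aeval_map_algebraMap]
      exact h A hA
    have := hx _ hf
    rwa [aeval_map_algebraMap] at this

/-- The positions of the variables that vanish on the matrix Schubert variety. -/
def corner (m : ℕ) : Set (Fin (m + 2) × Fin (m + 2)) :=
  {p | (p.1 : ℕ) + p.2 + 2 ≤ m}

theorem mem_corner {m : ℕ} {p : Fin (m + 2) × Fin (m + 2)} :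
    p ∈ corner m ↔ (p.1 : ℕ) + p.2 + 2 ≤ m := Iff.rfl

theorem cornerVars_eq_image (k : Type*) [Field k] (m : ℕ) :
    cornerVars k (m + 1) = X '' corner m := by
  ext f
  constructor
  · rintro ⟨i, j, h, rfl⟩
    exact ⟨(i, j), mem_corner.2 (by simp only; omega), rfl⟩
  · rintro ⟨⟨i, j⟩, h, rfl⟩
    exact ⟨i, j, by have := mem_corner.1 h; simp only at this; omega, rfl⟩

/-- The last diagonal position of the northwest submatrix of codimension one. -/
def pivot (m : ℕ) : Fin (m + 2) × Fin (m + 2) := (Fin.natAdd m 0, Fin.natAdd m 0)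

theorem pivot_notMem_corner (m : ℕ) : pivot m ∉ corner m := by
  rw [mem_corner]
  simp only [pivot, Fin.val_natAdd]
  omega

theorem aeval_det_submatrix {k K ι : Type*} [Field k] [Field K] [Algebra k K] [Fintype ι]
    [DecidableEq ι] {N : ℕ} (A : Matrix (Fin N) (Fin N) K) (r c : ι → Fin N) :
    aeval (fun p : Fin N × Fin N => A p.1 p.2)
      ((Matrix.mvPolynomialX (Fin N) (Fin N) k).submatrix r c).det = (A.submatrix r c).det := by
  rw [AlgHom.map_det]
  congr 1
  ext i j
  simp [Matrix.mvPolynomialX_apply]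

variable {k K : Type*} [Field k] [Field K] [Algebra k K] {m : ℕ}

theorem aeval_killVars_of_mem_orbit {A : Matrix (Fin (m + 2)) (Fin (m + 2)) K}
    (hA : A ∈ orbit K (extremePerm (m + 1)))
    (f : MvPolynomial (Fin (m + 2) × Fin (m + 2)) k) :
    aeval (fun p => A p.1 p.2) (killVars k (corner m) f) = aeval (fun p => A p.1 p.2) f :=
  aeval_killVars (fun _ hp => apply_eq_zero_of_mem_orbit hA hp) (fun _ _ => rfl) f

theorem killVars_mem_schubertIdeal {f : MvPolynomial (Fin (m + 2) × Fin (m + 2)) k}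
    (hf : f ∈ schubertIdeal k K (extremePerm (m + 1))) :
    killVars k (corner m) f ∈ schubertIdeal k K (extremePerm (m + 1)) :=
  mem_schubertIdeal_iff.2 fun A hA => by
    rw [aeval_killVars_of_mem_orbit hA, mem_schubertIdeal_iff.1 hf A hA]

theorem cornerVars_subset_schubertIdeal :
    cornerVars k (m + 1) ⊆ (schubertIdeal k K (extremePerm (m + 1)) : Set _) := by
  rw [cornerVars_eq_image]
  rintro _ ⟨p, hp, rfl⟩
  refine mem_schubertIdeal_iff.2 fun A hA => ?_
  rw [aeval_X, apply_eq_zero_of_mem_orbit hA hp]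

theorem northwestDet_mem_schubertIdeal :
    northwestDet k (m + 1) ∈ schubertIdeal k K (extremePerm (m + 1)) :=
  mem_schubertIdeal_iff.2 fun A hA => by
    rw [northwestDet, aeval_det_submatrix, det_submatrix_castSucc_of_mem_orbit hA]

/-- The product of minors whose nonvanishing singles out generic points of the orbit. -/
noncomputable def genericity (k : Type*) [Field k] (m : ℕ) :
    MvPolynomial (Fin (m + 2) × Fin (m + 2)) k :=
  ((Matrix.mvPolynomialX _ _ k).submatrix (Fin.castAdd 2 : Fin m → _) (Fin.castAdd 2)).det *
    ((Matrix.mvPolynomialX _ _ k).submatrix (bordered m 0) (bordered m 1)).det *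
      ((Matrix.mvPolynomialX _ _ k).submatrix (bordered m 1) (bordered m 0)).det

theorem aeval_genericity (A : Matrix (Fin (m + 2)) (Fin (m + 2)) K) :
    aeval (fun p => A p.1 p.2) (genericity k m) ≠ 0 ↔
      (A.submatrix (Fin.castAdd 2) (Fin.castAdd 2)).det ≠ 0 ∧ schurComplement A 0 1 ≠ 0 ∧
        schurComplement A 1 0 ≠ 0 := by
  rw [genericity, map_mul, map_mul, aeval_det_submatrix, aeval_det_submatrix, aeval_det_submatrix]
  by_cases hU : (A.submatrix (Fin.castAdd 2) (Fin.castAdd 2) : Matrix (Fin m) (Fin m) K).det = 0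
  · simp [hU]
  · rw [det_submatrix_bordered A 0 1 hU, det_submatrix_bordered A 1 0 hU]
    simp [hU]

/-- The permutation matrix is itself a generic point: its Schur complement is the swap. -/
theorem killVars_genericity_ne_zero : killVars k (corner m) (genericity k m) ≠ 0 := by
  intro h
  let P : Matrix (Fin (m + 2)) (Fin (m + 2)) k := (extremePerm (m + 1)).permMatrix k
  have hP : P ∈ orbit k (extremePerm (m + 1)) :=
    ⟨1, 1, Matrix.blockTriangular_one, Matrix.blockTriangular_one, by simp [P]⟩
  have h1 := aeval_killVars_of_mem_orbit (k := k) hP (genericity k m)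
  rw [h, map_zero] at h1
  have hb := submatrix_permMatrix_extremePerm (K := k) m
  have hU : P.submatrix (Fin.castAdd 2) (Fin.castAdd 2) =
      (Fin.revPerm : Equiv.Perm (Fin m)).permMatrix k := by
    ext i j
    exact congrFun (congrFun hb (Sum.inl i)) (Sum.inl j)
  have hC : P.submatrix (Fin.natAdd m) (Fin.castAdd 2) = (0 : Matrix (Fin 2) (Fin m) k) := by
    ext i j
    exact congrFun (congrFun hb (Sum.inr i)) (Sum.inl j)
  have hE : P.submatrix (Fin.natAdd m) (Fin.natAdd m) = !![0, 1; 1, 0] := by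
    ext i j
    exact congrFun (congrFun hb (Sum.inr i)) (Sum.inr j)
  refine (aeval_genericity (k := k) P).2 ⟨?_, ?_, ?_⟩ h1.symm
  · rw [hU, Matrix.det_permutation]
    rcases Int.units_eq_one_or (Equiv.Perm.sign (Fin.revPerm : Equiv.Perm (Fin m))) with h | h <;>
      simp [h]
  · simp [schurComplement, hC, hE]
  · simp [schurComplement, hC, hE]

/-- A polynomial that does not involve the corner variables nor the pivot variable and vanishes
on the orbit is zero. -/
theorem eq_zero_of_vanishes_on_orbit [Infinite K]
    {r : MvPolynomial (Fin (m + 2) × Fin (m + 2)) k}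
    (hr : r ∈ supported k {p | p ∉ corner m ∧ p ≠ pivot m})
    (h : ∀ A ∈ orbit K (extremePerm (m + 1)), aeval (fun p => A p.1 p.2) r = 0) : r = 0 := by
  classical
  -- Multiplying by the genericity polynomial restricts the check to generic points; `K` being
  -- infinite, vanishing at all points suffices.
  suffices hmul : r * killVars k (corner m) (genericity k m) = 0 from
    (mul_eq_zero.1 hmul).resolve_right killVars_genericity_ne_zero
  apply map_injective (algebraMap k K) (algebraMap k K).injective
  rw [map_zero]
  refine MvPolynomial.funext fun t => ?_
  rw [map_zero, ← aeval_eq_eval, aeval_map_algebraMap, map_mul]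
  by_cases h0 : aeval t (killVars k (corner m) (genericity k m)) = 0
  · rw [h0, mul_zero]
  let A₀ : Matrix (Fin (m + 2)) (Fin (m + 2)) K :=
    fun i j => if (i, j) ∈ corner m then 0 else t (i, j)
  rw [aeval_killVars (s := corner m) (t := t) (u := fun p => A₀ p.1 p.2)
    (fun p hp => if_pos hp) fun p hp => if_neg hp]
    at h0
  obtain ⟨hU, h01, h10⟩ := (aeval_genericity A₀).1 h0
  -- The pivot enters the Schur complement only additively in entry `(0, 0)`, so this shift makes
  -- that entry zero and leaves the others unchanged.
  let A : Matrix (Fin (m + 2)) (Fin (m + 2)) K :=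
    fun i j => if (i, j) = pivot m then A₀ i j - schurComplement A₀ 0 0 else A₀ i j
  have hne (i : Fin m) (a : Fin 2) : Fin.castAdd 2 i ≠ Fin.natAdd m a := by
    have := i.isLt
    rw [Ne, Fin.ext_iff, Fin.val_castAdd, Fin.val_natAdd]
    omega
  have hAU : A.submatrix (Fin.castAdd 2) (Fin.castAdd 2) =
      (A₀.submatrix (Fin.castAdd 2) (Fin.castAdd 2) : Matrix (Fin m) (Fin m) K) := by
    ext i j
    exact if_neg fun h => hne i 0 (congrArg Prod.fst h)
  have hAV : A.submatrix (Fin.castAdd 2) (Fin.natAdd m) =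
      (A₀.submatrix (Fin.castAdd 2) (Fin.natAdd m) : Matrix (Fin m) (Fin 2) K) := by
    ext i j
    exact if_neg fun h => hne i 0 (congrArg Prod.fst h)
  have hAC : A.submatrix (Fin.natAdd m) (Fin.castAdd 2) =
      (A₀.submatrix (Fin.natAdd m) (Fin.castAdd 2) : Matrix (Fin 2) (Fin m) K) := by
    ext i j
    exact if_neg fun h => hne j 0 (congrArg Prod.snd h)
  have hS (a b : Fin 2) : schurComplement A a b - A (Fin.natAdd m a) (Fin.natAdd m b) =
      schurComplement A₀ a b - A₀ (Fin.natAdd m a) (Fin.natAdd m b) := by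
    rw [schurComplement, schurComplement, hAU, hAV, hAC]
    simp only [Matrix.sub_apply, Matrix.submatrix_apply]
    ring
  have hAE (a b : Fin 2) (hab : (a, b) ≠ (0, 0)) : A (Fin.natAdd m a) (Fin.natAdd m b) =
      A₀ (Fin.natAdd m a) (Fin.natAdd m b) := by
    refine if_neg fun h => hab ?_
    simpa [pivot, Fin.natAdd_inj] using h
  have hAmem : A ∈ orbit K (extremePerm (m + 1)) := by
    refine mem_orbit_extremePerm A (fun i j hij => ?_) (hAU ▸ hU) ?_ ?_ ?_
    · have hij' : (i, j) ∈ corner m := hij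
      have hp : (i, j) ≠ pivot m := fun h => pivot_notMem_corner m (h ▸ hij')
      simp only [A, A₀, if_neg hp, if_pos hij']
    · have h1 := hS 0 0
      have h2 : A (Fin.natAdd m 0) (Fin.natAdd m 0) =
        A₀ (Fin.natAdd m 0) (Fin.natAdd m 0) - schurComplement A₀ 0 0 := if_pos rfl
      linear_combination h1 + h2
    · have h1 := hS 0 1
      rw [hAE 0 1 (by simp), sub_left_inj] at h1
      rwa [h1]
    · have h1 := hS 1 0
      rw [hAE 1 0 (by simp), sub_left_inj] at h1
      rwa [h1]
  rw [aeval_congr_of_mem_supported hr (u := fun p => A p.1 p.2), h A hAmem, zero_mul]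
  rintro p ⟨hp, hp'⟩
  simp only [A, A₀, Prod.mk.eta, if_neg hp, if_neg hp']

end Ideal

/-! ### The reduced determinant: terms, pivot coefficient, divisibility -/

section ReducedDet

/-- The northwest determinant with the corner variables set to zero. -/
noncomputable def reducedDet (k : Type*) [Field k] (m : ℕ) :
    MvPolynomial (Fin (m + 2) × Fin (m + 2)) k :=
  killVars k (corner m) (northwestDet k (m + 1))

/-- The exponent of the monomial of a permutation in the northwest determinant. -/
noncomputable def permExponent {n : ℕ} (τ : Equiv.Perm (Fin n)) :
    Fin (n + 1) × Fin (n + 1) →₀ ℕ :=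
  ∑ i, Finsupp.single ((τ i).castSucc, i.castSucc) 1

theorem permExponent_apply_eq_zero_iff {n : ℕ} {τ : Equiv.Perm (Fin n)}
    {p : Fin (n + 1) × Fin (n + 1)} :
    permExponent τ p = 0 ↔ ∀ i, ((τ i).castSucc, i.castSucc) ≠ p := by
  classical
  simp [permExponent, Finsupp.finsetSum_apply, Finsupp.single_apply]

theorem permExponent_injective (n : ℕ) :
    Function.Injective (permExponent : Equiv.Perm (Fin n) → _) := by
  intro τ τ' h
  ext1 i
  have h1 : permExponent τ ((τ i).castSucc, i.castSucc) ≠ 0 :=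
    fun h0 => permExponent_apply_eq_zero_iff.1 h0 i rfl
  rw [h, Ne, permExponent_apply_eq_zero_iff] at h1
  push Not at h1
  obtain ⟨j, hj⟩ := h1
  rw [Prod.mk.injEq, Fin.castSucc_inj, Fin.castSucc_inj] at hj
  rw [← hj.1, hj.2]

theorem northwestDet_eq_sum (k : Type*) [Field k] (n : ℕ) :
    northwestDet k n = ∑ τ : Equiv.Perm (Fin n),
      monomial (permExponent τ) ((Equiv.Perm.sign τ : ℤ) : k) := by
  rw [northwestDet, Matrix.det_apply']
  refine Finset.sum_congr rfl fun τ _ => ?_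
  rw [permExponent, ← mul_one ((Equiv.Perm.sign τ : ℤ) : k), ← C_mul_monomial,
    monomial_sum_one, map_intCast]
  rfl

/-- Distinct permutations give distinct monomials, and signs are nonzero in every characteristic. -/
theorem support_northwestDet (k : Type*) [Field k] (n : ℕ) :
    (northwestDet k n).support = Finset.univ.image permExponent := by
  classical
  ext d
  rw [mem_support_iff, northwestDet_eq_sum, coeff_sum]
  simp only [coeff_monomial, Finset.mem_image, Finset.mem_univ, true_and]
  constructor
  · intro h
    obtain ⟨τ, -, hτ⟩ := Finset.exists_ne_zero_of_sum_ne_zero h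
    exact ⟨τ, by_contra fun h => hτ (if_neg h)⟩
  · rintro ⟨τ, rfl⟩
    simp only [(permExponent_injective n).eq_iff, Finset.sum_ite_eq', Finset.mem_univ, if_true]
    rcases Int.units_eq_one_or (Equiv.Perm.sign τ) with h | h <;> simp [h]

variable (k : Type*) [Field k] (m : ℕ)

theorem support_reducedDet :
    (reducedDet k m).support = (Finset.univ.filter fun τ : Equiv.Perm (Fin (m + 1)) =>
      ∀ i, m ≤ (τ i : ℕ) + i + 1).image permExponent := by
  ext d
  rw [reducedDet, mem_support_killVars, support_northwestDet]
  simp only [Finset.mem_image, Finset.mem_univ, true_and, Finset.mem_filter]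
  constructor
  · rintro ⟨h, τ, rfl⟩
    refine ⟨τ, fun i => ?_, rfl⟩
    by_contra hi
    refine permExponent_apply_eq_zero_iff.1 (h ((τ i).castSucc, i.castSucc) ?_) i rfl
    rw [mem_corner]
    simp only [Fin.val_castSucc]
    omega
  · rintro ⟨τ, hτ, rfl⟩
    refine ⟨fun p hp => permExponent_apply_eq_zero_iff.2 fun i hi => ?_, τ, rfl⟩
    have := hτ i
    rw [← hi, mem_corner] at hp
    simp only [Fin.val_castSucc] at hp
    omega

theorem card_support_reducedDet : (reducedDet k m).support.card = 2 ^ m := by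
  rw [support_reducedDet, Finset.card_image_of_injective _ (permExponent_injective _),
    ← card_perm_le_succ m]
  -- Reversing values replaces `τ i` by `m - τ i`, so avoiding the corner becomes the bound `i + 1`.
  refine Finset.card_equiv (Equiv.mulLeft Fin.revPerm) fun τ => ?_
  simp only [Finset.mem_filter, Finset.mem_univ, true_and, Equiv.coe_mulLeft, Equiv.Perm.mul_apply,
    Fin.revPerm_apply, Fin.val_rev]
  refine forall_congr' fun i => ?_
  omega

theorem reducedDet_ne_zero : reducedDet k m ≠ 0 := by
  rw [← support_nonempty, ← Finset.card_pos, card_support_reducedDet]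
  positivity

theorem totalDegree_reducedDet : (reducedDet k m).totalDegree = m + 1 := by
  refine IsHomogeneous.totalDegree (fun d hd => ?_) (reducedDet_ne_zero k m)
  rw [← mem_support_iff, support_reducedDet] at hd
  obtain ⟨τ, -, rfl⟩ := Finset.mem_image.1 hd
  simp [permExponent, map_sum, Finsupp.weight_single]

theorem permExponent_revPerm_mem_support :
    permExponent Fin.revPerm ∈ (reducedDet k m).support := by
  rw [support_reducedDet]
  refine Finset.mem_image_of_mem _ (Finset.mem_filter.2 ⟨Finset.mem_univ _, fun i => ?_⟩)
  rw [Fin.revPerm_apply, Fin.val_rev]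
  omega

theorem permExponent_revPerm_apply {p : Fin (m + 2) × Fin (m + 2)}
    (hp : (p.1 : ℕ) + p.2 ≠ m) : permExponent (Fin.revPerm : Equiv.Perm (Fin (m + 1))) p = 0 := by
  refine permExponent_apply_eq_zero_iff.2 fun i hi => hp ?_
  rw [← hi]
  simp only [Fin.revPerm_apply, Fin.val_castSucc, Fin.val_rev]
  omega

theorem not_X_dvd_reducedDet {p : Fin (m + 2) × Fin (m + 2)} (hp : (p.1 : ℕ) + p.2 ≠ m) :
    ¬ X p ∣ reducedDet k m := by
  classical
  rintro ⟨q, hq⟩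
  have h := permExponent_revPerm_mem_support k m
  rw [hq, mem_support_iff, coeff_X_mul', if_neg] at h
  · exact h rfl
  · rw [Finsupp.mem_support_iff, not_not]
    exact permExponent_revPerm_apply m hp

/-- The generic matrix with the corner variables set to zero. -/
noncomputable def cornerZeroMatrix :
    Matrix (Fin (m + 2)) (Fin (m + 2)) (MvPolynomial (Fin (m + 2) × Fin (m + 2)) k) :=
  fun i j => killVars k (corner m) (X (i, j))

theorem cornerZeroMatrix_mem_supported {i j : Fin (m + 2)} (h : (i, j) ≠ pivot m) :
    cornerZeroMatrix k m i j ∈ supported k {p | p ∉ corner m ∧ p ≠ pivot m} := by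
  rw [cornerZeroMatrix]
  by_cases hc : (i, j) ∈ corner m
  · rw [killVars_X_of_mem hc]
    exact zero_mem _
  · rw [killVars_X_of_notMem hc]
    exact X_mem_supported.2 ⟨hc, h⟩

theorem reducedDet_eq_det :
    reducedDet k m = ((cornerZeroMatrix k m).submatrix Fin.castSucc Fin.castSucc).det := by
  rw [reducedDet, northwestDet, AlgHom.map_det]
  rfl

/-- The coefficient of the pivot variable in the reduced determinant. -/
noncomputable def pivotCoeff : MvPolynomial (Fin (m + 2) × Fin (m + 2)) k :=
  ((cornerZeroMatrix k m).submatrix (Fin.castAdd 2) (Fin.castAdd 2)).det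

theorem castSucc_castSucc_ne_pivot_fst (i : Fin m) : i.castSucc.castSucc ≠ (pivot m).1 := by
  have := i.isLt
  rw [Ne, Fin.ext_iff]
  simp only [pivot, Fin.val_castSucc, Fin.val_natAdd]
  omega

theorem pivotCoeff_mem_supported :
    pivotCoeff k m ∈ supported k {p | p ∉ corner m ∧ p ≠ pivot m} :=
  det_mem _ _ fun i _ => cornerZeroMatrix_mem_supported k m fun h =>
    castSucc_castSucc_ne_pivot_fst m i (congrArg Prod.fst h)

theorem exists_reducedDet_eq :
    ∃ b ∈ supported k {p | p ∉ corner m ∧ p ≠ pivot m},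
      reducedDet k m = pivotCoeff k m * X (pivot m) + b := by
  let M := (cornerZeroMatrix k m).submatrix (Fin.castSucc : Fin (m + 1) → _) Fin.castSucc
  -- Laplace expansion along the last row: `b` collects every term but the pivot one, and its minors
  -- omit the pivot row.
  refine ⟨∑ j : Fin m, (-1) ^ ((Fin.last m : ℕ) + (j.castSucc : ℕ)) * M (Fin.last m) j.castSucc *
    (M.submatrix (Fin.last m).succAbove j.castSucc.succAbove).det, ?_, ?_⟩
  · refine sum_mem fun j _ => mul_mem (mul_mem (pow_mem (neg_mem (one_mem _)) _) ?_)
      (det_mem _ _ fun i l => ?_)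
    · exact cornerZeroMatrix_mem_supported k m fun h =>
        castSucc_castSucc_ne_pivot_fst m j (congrArg Prod.snd h)
    · refine cornerZeroMatrix_mem_supported k m fun h =>
        castSucc_castSucc_ne_pivot_fst m i ?_
      rw [← congrArg Prod.fst h, Fin.succAbove_last]
  · rw [reducedDet_eq_det, Matrix.det_succ_row _ (Fin.last m), Fin.sum_univ_castSucc]
    refine (add_comm _ _).trans (congrArg₂ _ ?_ rfl)
    rw [Even.neg_one_pow (Even.add_self _), one_mul, mul_comm, Fin.succAbove_last]
    congr 1
    exact killVars_X_of_notMem (pivot_notMem_corner m)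

/-- The corner zeros make the `m × m` block triangular after reversing columns, so only its
antidiagonal, the positions with `i + j + 1 = m`, survives. -/
theorem pivotCoeff_eq :
    pivotCoeff k m =
      ((Equiv.Perm.sign (Fin.revPerm : Equiv.Perm (Fin m)) : ℤ) : MvPolynomial _ k) *
      ∏ i : Fin m, X (Fin.castAdd 2 i, Fin.castAdd 2 i.rev) := by
  let U := (cornerZeroMatrix k m).submatrix (Fin.castAdd 2 : Fin m → _) (Fin.castAdd 2)
  have hL : (U.submatrix id Fin.rev).IsLowerTriangular := by
    intro i j hij
    rw [OrderDual.toDual_lt_toDual, Fin.lt_def] at hij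
    refine killVars_X_of_mem ?_
    rw [mem_corner]
    simp only [Fin.val_castAdd, Fin.val_rev, id]
    omega
  have h := Matrix.det_permute' (Fin.revPerm : Equiv.Perm (Fin m)) (U.submatrix id Fin.rev)
  rw [Matrix.det_of_isLowerTriangular _ hL, Matrix.submatrix_submatrix,
    show Fin.rev ∘ (Fin.revPerm : Equiv.Perm (Fin m)) = id by funext i; simp,
    Function.comp_id, Matrix.submatrix_id_id] at h
  rw [pivotCoeff, h]
  congr 1
  refine Finset.prod_congr rfl fun i _ => killVars_X_of_notMem ?_
  rw [mem_corner]
  simp only [Fin.val_castAdd, Fin.val_rev, id]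
  omega

/-- The pivot coefficient is a monomial in variables with `i + j + 1 = m`, none of which occurs in
the antidiagonal term of the reduced determinant, where `i + j = m`. -/
theorem isRelPrime_reducedDet_pivotCoeff : IsRelPrime (reducedDet k m) (pivotCoeff k m) := by
  rw [pivotCoeff_eq]
  refine IsRelPrime.symm (IsRelPrime.mul_left ?_ (IsRelPrime.prod_left fun i _ => ?_))
  · refine IsUnit.isRelPrime_left ?_
    rcases Int.units_eq_one_or (Equiv.Perm.sign (Fin.revPerm : Equiv.Perm (Fin m))) with h | h <;>
      simp [h]
  · refine (X_prime.irreducible.isRelPrime_iff_not_dvd).2 (not_X_dvd_reducedDet k m ?_)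
    simp only [Fin.val_castAdd, Fin.val_rev]
    have := i.isLt
    omega

variable {k m}

theorem reducedDet_dvd_killVars {K : Type*} [Field K] [Algebra k K] [Infinite K]
    {f : MvPolynomial (Fin (m + 2) × Fin (m + 2)) k}
    (hf : f ∈ schubertIdeal k K (extremePerm (m + 1))) :
    reducedDet k m ∣ killVars k (corner m) f := by
  obtain ⟨b, hb, hdet⟩ := exists_reducedDet_eq k m
  obtain ⟨e, q, r, hr, h⟩ :=
    exists_pow_mul_killVars_eq (corner m) (pivot m) (pivotCoeff_mem_supported k m) hb f
  rw [← hdet] at h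
  have hr0 : r = 0 := by
    refine eq_zero_of_vanishes_on_orbit (K := K) hr (mem_schubertIdeal_iff.1 ?_)
    rw [show r = pivotCoeff k m ^ e * killVars k (corner m) f - q * reducedDet k m by
      rw [h]; ring]
    exact sub_mem (Ideal.mul_mem_left _ _ (killVars_mem_schubertIdeal hf))
      (Ideal.mul_mem_left _ _ (killVars_mem_schubertIdeal northwestDet_mem_schubertIdeal))
  rw [hr0, add_zero] at h
  exact (isRelPrime_reducedDet_pivotCoeff k m).pow_right.dvd_of_dvd_mul_left
    (Dvd.intro_left q h.symm)

end ReducedDet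

/-! ### Lead monomials and the two Gröbner bases -/

section Main

variable {k K : Type*} [Field k] [Field K] [Algebra k K] {m : ℕ}
  {o : MonomialOrder (Fin (m + 2) × Fin (m + 2))}

theorem IsAntidiagonal.degree_northwestDet (ho : IsAntidiagonal k o) :
    o.degree (northwestDet k (m + 1)) = permExponent Fin.revPerm := by
  have h := ho (m + 1) Fin.castSuccOrderEmb Fin.castSuccOrderEmb
  rw [minor_castSucc k _ _ (fun _ => rfl) fun _ => rfl] at h
  rw [h, permExponent, ← Equiv.sum_comp Fin.revPerm]
  simp

/-- Killing variables only deletes terms, and the antidiagonal one survives. -/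
theorem IsAntidiagonal.degree_reducedDet (ho : IsAntidiagonal k o) :
    o.degree (reducedDet k m) = permExponent Fin.revPerm := by
  refine o.toSyn.injective (le_antisymm ?_ (o.le_degree (permExponent_revPerm_mem_support k m)))
  rw [← ho.degree_northwestDet]
  exact o.degree_le_degree_of_support_subset fun d hd => (mem_support_killVars.1 hd).2

theorem finite_cornerVars : (cornerVars k (m + 1)).Finite := by
  rw [cornerVars_eq_image]
  exact (Set.toFinite _).image _

/-- The corner variables together with any element of the Schubert determinantal ideal with
antidiagonal lead term form a Gröbner basis. -/
theorem IsAntidiagonal.isGroebnerBasis [Infinite K] (ho : IsAntidiagonal k o)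
    {g : MvPolynomial (Fin (m + 2) × Fin (m + 2)) k}
    (hg : g ∈ schubertIdeal k K (extremePerm (m + 1))) (hg0 : g ≠ 0)
    (hd : o.degree g = permExponent Fin.revPerm) :
    IsGroebnerBasis o (schubertIdeal k K (extremePerm (m + 1)))
      (cornerVars k (m + 1) ∪ {g}) := by
  refine isGroebnerBasis_of_forall_exists_degree_le
    (finite_cornerVars.union (Set.finite_singleton g))
    (Set.union_subset cornerVars_subset_schubertIdeal (Set.singleton_subset_iff.2 hg)) ?_
  intro f hf hf0
  -- If the lead monomial avoids the corner it survives the substitution and is the lead monomial of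
  -- a multiple of `reducedDet`; otherwise a corner variable divides it.
  by_cases hc : ∀ p ∈ corner m, o.degree f p = 0
  · refine ⟨g, Or.inr rfl, hg0, ?_⟩
    have hmem : o.degree f ∈ (killVars k (corner m) f).support :=
      mem_support_killVars.2 ⟨hc, o.degree_mem_support hf0⟩
    have hdeg : o.degree (killVars k (corner m) f) = o.degree f :=
      o.toSyn.injective (le_antisymm (o.degree_le_degree_of_support_subset fun d hd =>
        (mem_support_killVars.1 hd).2) (o.le_degree hmem))
    have hne : killVars k (corner m) f ≠ 0 := support_nonempty.1 ⟨_, hmem⟩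
    obtain ⟨q, hq⟩ := reducedDet_dvd_killVars hf
    rw [hq] at hdeg hne
    rw [hd, ← ho.degree_reducedDet, ← hdeg, o.degree_mul' hne]
    exact le_self_add
  · push Not at hc
    obtain ⟨p, hp, hfp⟩ := hc
    refine ⟨X p, Or.inl ?_, X_ne_zero p, ?_⟩
    · rw [cornerVars_eq_image]
      exact Set.mem_image_of_mem _ hp
    · rw [o.degree_X, Finsupp.single_le_iff]
      exact Nat.one_le_iff_ne_zero.2 hfp

theorem IsAntidiagonal.isReducedGroebnerBasis [Infinite K] (hm : 1 ≤ m)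
    (ho : IsAntidiagonal k o) :
    IsReducedGroebnerBasis o (schubertIdeal k K (extremePerm (m + 1)))
      (cornerVars k (m + 1) ∪ {reducedDet k m}) := by
  classical
  refine ⟨ho.isGroebnerBasis (killVars_mem_schubertIdeal northwestDet_mem_schubertIdeal)
    (reducedDet_ne_zero k m) ho.degree_reducedDet, ?_, ?_⟩
  · rw [cornerVars_eq_image]
    rintro (⟨p, -, hp⟩ | h)
    · exact X_ne_zero p hp
    · exact reducedDet_ne_zero k m h.symm
  · rw [cornerVars_eq_image]
    intro g₁ h₁ g₂ h₂ hne s hs hdvd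
    rw [MonomialOrder.leadingTerm, monomial_dvd_monomial] at hdvd
    have hle := hdvd.1.resolve_left (mem_support_iff.1 hs)
    rcases h₁ with ⟨p, hp, rfl⟩ | rfl
    · rw [o.degree_X, Finsupp.single_le_iff] at hle
      rcases h₂ with ⟨q, hq, rfl⟩ | rfl
      · rw [support_X, Finset.mem_singleton] at hs
        subst hs
        rw [Finsupp.single_apply] at hle
        split_ifs at hle with hqp
        · exact hne (hqp ▸ rfl)
        · omega
      · have := (mem_support_killVars.1 hs).1 p hp
        omega
    · rcases h₂ with ⟨q, hq, rfl⟩ | rfl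
      · rw [support_X, Finset.mem_singleton] at hs
        subst hs
        rw [ho.degree_reducedDet] at hle
        -- The antidiagonal monomial contains the variable at `(m, 0)`, outside the corner, so it
        -- cannot divide a corner variable.
        let i : Fin (m + 1) := 0
        let p : Fin (m + 2) × Fin (m + 2) := (i.rev.castSucc, i.castSucc)
        have hp : permExponent (Fin.revPerm : Equiv.Perm (Fin (m + 1))) p ≠ 0 :=
          fun h => permExponent_apply_eq_zero_iff.1 h i rfl
        have hqp : q ≠ p := by
          rintro rfl
          rw [mem_corner] at hq
          simp only [p, i, Fin.val_castSucc, Fin.val_rev, Fin.val_zero] at hq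
          omega
        have := hle p
        rw [Finsupp.single_apply, if_neg hqp] at this
        omega
      · exact hne rfl

end Main

end Schubert

theorem mainTheorem6 {k K : Type*} [Field k] [Field K] [Algebra k K] [Infinite K]
    (n : ℕ) (hn : 3 ≤ n) :
    Schubert.elusiveMinors k (Schubert.extremePerm n) =
        Schubert.cornerVars k n ∪ {Schubert.northwestDet k n} ∧
      (∀ m : MonomialOrder (Fin (n + 1) × Fin (n + 1)), Schubert.IsAntidiagonal k m →
        Schubert.IsGroebnerBasis m (Schubert.schubertIdeal k K (Schubert.extremePerm n))
          (Schubert.elusiveMinors k (Schubert.extremePerm n))) ∧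
      ∃ g' : MvPolynomial (Fin (n + 1) × Fin (n + 1)) k,
        g'.totalDegree = n ∧ g'.support.card = 2 ^ (n - 1) ∧
        ∀ m : MonomialOrder (Fin (n + 1) × Fin (n + 1)), Schubert.IsAntidiagonal k m →
          Schubert.IsReducedGroebnerBasis m
              (Schubert.schubertIdeal k K (Schubert.extremePerm n))
              (Schubert.cornerVars k n ∪ {g'}) ∧
            ∀ G' : Set (MvPolynomial (Fin (n + 1) × Fin (n + 1)) k),
              Schubert.IsReducedGroebnerBasis m
                  (Schubert.schubertIdeal k K (Schubert.extremePerm n)) G' →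
                Schubert.EqUpToScalars (Schubert.cornerVars k n ∪ {g'}) G' := by
  obtain ⟨m, rfl⟩ : ∃ m, n = m + 1 := ⟨n - 1, by omega⟩
  refine ⟨Schubert.elusiveMinors_extremePerm k hn, fun o ho => ?_, Schubert.reducedDet k m,
    Schubert.totalDegree_reducedDet k m, Schubert.card_support_reducedDet k m, fun o ho => ?_⟩
  · rw [Schubert.elusiveMinors_extremePerm k hn]
    refine ho.isGroebnerBasis Schubert.northwestDet_mem_schubertIdeal (fun h => ?_)
      ho.degree_northwestDet
    have h0 := Schubert.reducedDet_ne_zero k m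
    rw [Schubert.reducedDet, h, map_zero] at h0
    exact h0 rfl
  · have h := ho.isReducedGroebnerBasis (K := K) (by omega)
    exact ⟨h, fun G' hG' => h.eqUpToScalars hG'⟩
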